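/- Let $(M^n,g)$ be a Riemannian spin manifold and $k$ a symmetric $2$-tensor on $M$. Let $\mathcal S$ be the complex spinor bundle of $M$ with its Hermitian product and the connection $\nabla$ induced by the Levi-Civita connection, where vectors act by skew-Hermitian maps with $e_ie_j+e_je_i=-2\delta_{ij}$ for every local orthonormal frame $e_1,\dots,e_n$. Let $\overline{\mathcal S}=\mathcal S\oplus\mathcal S$ carry the direct sum Hermitian product (complex linear in the first slot), the direct sum connection, again denoted $\nabla$, and the Clifford action $$e_l(\psi_1,\psi_2)=(e_l\psi_1,-e_l\psi_2),\qquad e_0(\psi_1,\psi_2)=(\psi_2,\psi_1).$$ For a section $\psi$ of $\overline{\mathcal S}$ set $$N=|\psi|^2,\qquad X=\sum_i\langle e_ie_0\psi,\psi\rangle e_i,\qquad Y=\sum_i\langle \mathbf i e_i\psi,\psi\rangle e_i,\qquad \omega_{ij}=\operatorname{Im}\langle e_ie_je_0\psi,\psi\rangle ,$$ where $X$ and $Y$ are (real) vector fields and the two-form $\omega$ acts on $\overline{\mathcal S}$ by $\sum_{i,j=1}^n\omega_{ij}e_ie_j$. Let $1\le r\le\infty$ and suppose that a section $\psi$ of $\overline{\mathcal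 S}$ of class $C^r$ solves, for every local orthonormal frame and every $i$, $$\nabla_i\psi=-\tfrac12\sum_jk_{ij}e_je_0\psi-\tfrac12\mathbf i e_i\psi .$$ Then $$\varphi=e_0\bigl(N-\mathbf iY+e_0X-\tfrac12\mathbf i e_0\omega\bigr)\psi$$ is a section of $\overline{\mathcal S}$ of class $C^r$ and solves the same equation, $$\nabla_i\varphi=-\tfrac12\sum_jk_{ij}e_je_0\varphi-\tfrac12\mathbf i e_i\varphi .$$ -/

import Mathlib

open Bundle Set Manifold
open scoped ContDiff InnerProductSpace

noncomputable section

/-! ### Clifford algebra and spinor modules -/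

/-- Euclidean space `ℝⁿ`. -/
abbrev EucSp (n : ℕ) : Type := EuclideanSpace ℝ (Fin n)

/-- The quadratic form `v ↦ -|v|²` on `ℝⁿ`; in its Clifford algebra `e_i e_i = -1`. -/
def negForm (n : ℕ) : QuadraticForm ℝ (EucSp n) :=
  -LinearMap.BilinMap.toQuadraticMap (innerₗ (EucSp n))

/-- The real Clifford algebra `Cl(n)` with `v * v = -|v|²`. Mathlib's `spinGroup (negForm n)`
inside it is the group `Spin(n)`. -/
abbrev Cl (n : ℕ) : Type := CliffordAlgebra (negForm n)

/-- Clifford vectors in `Cl(n)`. -/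
abbrev clι (n : ℕ) : EucSp n →ₗ[ℝ] Cl n := CliffordAlgebra.ι (negForm n)

lemma clι_mul_self (n : ℕ) (v : EucSp n) :
    clι n v * clι n v = algebraMap ℝ (Cl n) (-(‖v‖ ^ 2)) := by
  rw [CliffordAlgebra.ι_sq_scalar]
  congr 1
  simp [negForm]

/-- A (complex) spinor module: an irreducible complex representation of `Cl(n)` on a
Hermitian vector space `S` for which vectors act by skew-Hermitian maps. -/
structure SpinorModule (n : ℕ) (S : Type*) [NormedAddCommGroup S] [InnerProductSpace ℂ S] where
  /-- The representation of the Clifford algebra. -/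
  rep : Cl n →ₐ[ℝ] Module.End ℂ S
  skew : ∀ (v : EucSp n) (a b : S), ⟪rep (clι n v) a, b⟫_ℂ = -⟪a, rep (clι n v) b⟫_ℂ
  nontrivial : Nontrivial S
  irreducible : ∀ W : Submodule ℂ S, (∀ v : EucSp n, ∀ a ∈ W, rep (clι n v) a ∈ W) →
    W = ⊥ ∨ W = ⊤

/-- The model fibre `S ⊕ S` of the spacetime spinor bundle, with its Hermitian direct sum
structure. -/
abbrev Dbl (S : Type*) : Type _ := WithLp 2 (S × S)

section Algebra

variable {n : ℕ} {S : Type*} [NormedAddCommGroup S] [InnerProductSpace ℂ S]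

/-- The endomorphism `(a, b) ↦ (f a, h b)` of `S ⊕ S`. -/
def dblMap (f h : Module.End ℂ S) : Module.End ℂ (Dbl S) where
  toFun p := WithLp.toLp 2 (f p.fst, h p.snd)
  map_add' p q := by simp [← WithLp.toLp_add]
  map_smul' c p := by simp [← WithLp.toLp_smul]

lemma dblMap_mul (f f' h h' : Module.End ℂ S) :
    dblMap f h * dblMap f' h' = dblMap (f * f') (h * h') := rfl

lemma dblMap_one : dblMap (1 : Module.End ℂ S) 1 = 1 := rfl

/-- `e₀ (a, b) = (b, a)`. -/
def e0 : Module.End ℂ (Dbl S) where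
  toFun p := WithLp.toLp 2 (p.snd, p.fst)
  map_add' p q := by simp [← WithLp.toLp_add]
  map_smul' c p := by simp [← WithLp.toLp_smul]

namespace SpinorModule

variable (σ : SpinorModule n S)

/-- Clifford multiplication on `S ⊕ S` by the vector with coordinates `v`:
`v (a, b) = (v a, - v b)`. -/
def cl (v : EucSp n) : Module.End ℂ (Dbl S) :=
  dblMap (σ.rep (clι n v)) (-σ.rep (clι n v))

/-- Clifford multiplication by the `i`-th standard basis vector. -/
def e (i : Fin n) : Module.End ℂ (Dbl S) := σ.cl (EuclideanSpace.single i 1)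

/-- The Hermitian product `⟨a, b⟩`, complex linear in the first slot (Mathlib's `⟪b, a⟫_ℂ` is
conjugate linear in `b`). -/
def herm (a b : Dbl S) : ℂ := ⟪b, a⟫_ℂ

/-- `N(ψ) = |ψ|²`. -/
def N (p : Dbl S) : ℝ := ‖p‖ ^ 2

/-- `X(ψ) = ∑ ⟨e_i e₀ ψ, ψ⟩ e_i` in coordinates; the products `⟨e_i e₀ ψ, ψ⟩` are real. -/
def X (p : Dbl S) : EucSp n :=
  WithLp.toLp 2 fun i => (herm (σ.e i (e0 p)) p).re

/-- `Y(ψ) = ∑ ⟨𝐢 e_i ψ, ψ⟩ e_i` in coordinates; the products `⟨𝐢 e_i ψ, ψ⟩` are real. -/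
def Y (p : Dbl S) : EucSp n :=
  WithLp.toLp 2 fun i => (herm (Complex.I • σ.e i p) p).re

/-- `ω_ij(ψ) = Im ⟨e_i e_j e₀ ψ, ψ⟩`. -/
def om (p : Dbl S) (i j : Fin n) : ℝ := (herm (σ.e i (σ.e j (e0 p))) p).im

/-- Clifford action `∑_{i,j} ω_ij e_i e_j` of the two-form `ω(ψ)`. -/
def clom (p : Dbl S) : Module.End ℂ (Dbl S) := ∑ i, ∑ j, (σ.om p i j : ℂ) • (σ.e i * σ.e j)

/-- `e₀ (N(ψ) - 𝐢 Y(ψ) + e₀ X(ψ) - ½ 𝐢 e₀ ω(ψ)) ψ`. -/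
def hidden (p : Dbl S) : Dbl S :=
  (e0 * ((N p : ℂ) • 1 - Complex.I • σ.cl (σ.Y p) + e0 * σ.cl (σ.X p)
    - (Complex.I / 2) • (e0 * σ.clom p)) : Module.End ℂ (Dbl S)) p

end SpinorModule

end Algebra

/-! ### Riemannian spin manifolds -/

section Geometry

variable {n : ℕ} {M : Type*} [TopologicalSpace M] [ChartedSpace (EucSp n) M]
  [IsManifold (𝓡 n) ∞ M]

variable (n M) in
/-- Smooth Riemannian metrics on the `n`-manifold `M`. -/
abbrev RMetric : Type _ :=
  ContMDiffRiemannianMetric (𝓡 n) ∞ (EucSp n) (fun x : M => TangentSpace (𝓡 n) x)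

/-- A spin structure on the Riemannian manifold `(M, g)`, in terms of local trivializations: an
open cover with smooth orthonormal frames on its members, together with a smooth
`Spin(n)`-valued cocycle that lifts the transition functions of the frames. -/
structure SpinStructure (g : RMetric n M) (ι : Type*) where
  /-- The members of the open cover. -/
  baseSet : ι → Set M
  isOpen_baseSet : ∀ a, IsOpen (baseSet a)
  /-- A choice of a member of the cover around each point. -/
  indexAt : M → ι
  mem_baseSet_at : ∀ x, x ∈ baseSet (indexAt x)
  /-- The local frames. -/
  frame : ι → Fin n → ∀ x : M, TangentSpace (𝓡 n) x
  contMDiffOn_frame : ∀ a i, ContMDiffOn (𝓡 n) (𝓡 n).tangent ∞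
    (fun x => (⟨x, frame a i x⟩ : TangentBundle (𝓡 n) M)) (baseSet a)
  orthonormal : ∀ a, ∀ x ∈ baseSet a, ∀ i j,
    g.inner x (frame a i x) (frame a j x) = if i = j then 1 else 0
  /-- The cocycle: `lift a b` passes from the trivialization `b` to the trivialization `a`. -/
  lift : ι → ι → M → Cl n
  lift_mem : ∀ a b, ∀ x ∈ baseSet a ∩ baseSet b, lift a b x ∈ spinGroup (negForm n)
  /-- Smoothness of `lift a b` as a map into the finite-dimensional space `Cl(n)`. -/
  contMDiffOn_lift : ∀ a b, ∀ f : Cl n →ₗ[ℝ] ℝ,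
    ContMDiffOn (𝓡 n) 𝓘(ℝ, ℝ) ∞ (fun x => f (lift a b x)) (baseSet a ∩ baseSet b)
  lift_self : ∀ a, ∀ x ∈ baseSet a, lift a a x = 1
  lift_comp : ∀ a b c, ∀ x ∈ baseSet a ∩ baseSet b ∩ baseSet c,
    lift a b x * lift b c x = lift a c x
  /-- If a tangent vector has coordinates `v` in the frame `a` and `w` in the frame `b`, then
  `v = lift a b · w · (lift a b)⁻¹` in `Cl(n)`. -/
  lift_covers : ∀ a b, ∀ x ∈ baseSet a ∩ baseSet b, ∀ v w : EucSp n,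
    ∑ i, v i • frame a i x = ∑ i, w i • frame b i x →
      clι n v * lift a b x = lift a b x * clι n w

variable {g : RMetric n M} {ι : Type*}
  {S : Type*} [NormedAddCommGroup S] [InnerProductSpace ℂ S] [FiniteDimensional ℂ S]

/-- The diagonal action `f ↦ (f, f)` as an `ℝ`-linear map into the bounded operators. -/
def dblDiag : Module.End ℂ S →ₗ[ℝ] (Dbl S →L[ℂ] Dbl S) where
  toFun f := LinearMap.toContinuousLinearMap (dblMap f f)
  map_add' _ _ := rfl
  map_smul' _ _ := rfl

lemma continuousOn_of_functionals {F : Type*} [NormedAddCommGroup F] [NormedSpace ℝ F]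
    [FiniteDimensional ℝ F] {B : Type*} [TopologicalSpace B] {s : Set B} {u : B → F}
    (h : ∀ f : F →ₗ[ℝ] ℝ, ContinuousOn (fun x => f (u x)) s) : ContinuousOn u s := by
  let b := Module.finBasis ℝ F
  have : u = fun x => b.equivFunL.symm (fun i => b.coord i (u x)) := by
    funext x
    exact (b.equivFunL.symm_apply_apply (u x)).symm
  rw [this]
  exact b.equivFunL.symm.continuous.comp_continuousOn
    (continuousOn_pi.2 fun i => h (b.coord i))

/-- The spacetime spinor bundle `𝒮 ⊕ 𝒮`, where `𝒮` is the vector bundle with fibre `S`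
associated to the spin structure: the transition functions are `(p, q) ↦ (s p, s q)` with `s` the
action of the `Spin(n)`-valued cocycle. -/
def SpinStructure.spinorBundle (P : SpinStructure g ι) (σ : SpinorModule n S) :
    VectorBundleCore ℂ M (Dbl S) ι where
  baseSet := P.baseSet
  isOpen_baseSet := P.isOpen_baseSet
  indexAt := P.indexAt
  mem_baseSet_at := P.mem_baseSet_at
  coordChange a b x := dblDiag (σ.rep (P.lift b a x))
  coordChange_self a x hx v := by
    rw [P.lift_self a x hx, map_one]
    rfl
  continuousOn_coordChange a b := by
    have : FiniteDimensional ℝ (Dbl S →L[ℂ] Dbl S) := FiniteDimensional.complexToReal _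
    refine continuousOn_of_functionals fun f => ?_
    have h := (P.contMDiffOn_lift b a (f ∘ₗ dblDiag ∘ₗ σ.rep.toLinearMap)).continuousOn
    rw [inter_comm] at h
    exact h
  coordChange_comp a b c x hx v := by
    rw [← P.lift_comp c b a x ⟨⟨hx.2, hx.1.2⟩, hx.1.1⟩, map_mul]
    rfl

namespace SpinStructure

variable (P : SpinStructure g ι) (σ : SpinorModule n S)

/-- Spacetime spinors: sections of the spacetime spinor bundle. The fibre over `x` is, as a type,
`S ⊕ S`, identified by the trivialization with index `P.indexAt x`. -/
abbrev Spinor : Type _ := ∀ x : M, (P.spinorBundle σ).Fiber x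

variable {σ}

/-- The section is of class `C^r`. -/
def IsCr (r : ℕ∞) (ψ : P.Spinor σ) : Prop :=
  ContMDiff (𝓡 n) ((𝓡 n).prod 𝓘(ℝ, Dbl S)) r
    (fun x => TotalSpace.mk' (Dbl S) (E := (P.spinorBundle σ).Fiber) x (ψ x))

/-- The representative of a spinor in the trivialization with index `a`. -/
def localRep (a : ι) (ψ : P.Spinor σ) (y : M) : Dbl S :=
  (P.spinorBundle σ).coordChange (P.indexAt y) a y (ψ y)

/-- The coefficients `Γ_ijk = g(∇_{e_i} e_j, e_k)` of the Levi-Civita connection in the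
orthonormal frame with index `a`, by the Koszul formula. -/
def connCoeff (a : ι) (x : M) (i j k : Fin n) : ℝ :=
  let br (i j : Fin n) : TangentSpace (𝓡 n) x :=
    VectorField.mlieBracket (𝓡 n) (P.frame a i) (P.frame a j) x
  (g.inner x (br i j) (P.frame a k x) - g.inner x (br j k) (P.frame a i x)
    + g.inner x (br k i) (P.frame a j x)) / 2

/-- The `j`-th coordinate of a tangent vector at `x`, in the frame with index `P.indexAt x`. -/
def coord (x : M) (v : TangentSpace (𝓡 n) x) : EucSp n :=
  WithLp.toLp 2 fun j => g.inner x v (P.frame (P.indexAt x) j x)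

/-- The spin connection on `𝒮 ⊕ 𝒮`: in a local orthonormal frame and the corresponding
trivialization, `∇_v ψ = ∂_v ψ + ¼ ∑_{j,k} g(∇_v e_j, e_k) e_j e_k ψ` on each summand `𝒮`.
At `x` the frame with index `P.indexAt x` is used. -/
def nabla (ψ : P.Spinor σ) (x : M) (v : TangentSpace (𝓡 n) x) : (P.spinorBundle σ).Fiber x :=
  let a := P.indexAt x
  let dψ : TangentSpace (𝓡 n) x →L[ℝ] Dbl S :=
    mfderiv (𝓡 n) 𝓘(ℝ, Dbl S) (P.localRep a ψ) x
  let Ω : Cl n := ∑ i, ∑ j, ∑ k, (P.coord x v i * P.connCoeff a x i j k / 4) •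
    (clι n (EuclideanSpace.single j 1) * clι n (EuclideanSpace.single k 1))
  (dψ v + dblDiag (σ.rep Ω) (ψ x) : Dbl S)

/-- The equation `∇_v ψ = -½ ∑_j k(v, e_j) e_j e₀ ψ - ½ 𝐢 v ψ` for all tangent vectors `v`. -/
def IsKillingSpinor (k : ∀ x : M, TangentSpace (𝓡 n) x →ₗ[ℝ] TangentSpace (𝓡 n) x →ₗ[ℝ] ℝ)
    (ψ : P.Spinor σ) : Prop :=
  ∀ (x : M) (v : TangentSpace (𝓡 n) x),
    P.nabla ψ x v =
      (-(1 / 2 : ℂ) • ∑ j, (k x v (P.frame (P.indexAt x) j x) : ℂ) • σ.e j (e0 (ψ x))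
        - (Complex.I / 2) • σ.cl (P.coord x v) (ψ x) : Dbl S)

/-- The spinor `φ = e₀ (N(ψ) - 𝐢 Y(ψ) + e₀ X(ψ) - ½ 𝐢 e₀ ω(ψ)) ψ`, computed at each point in the
orthonormal frame and trivialization with index `P.indexAt x`; every other index gives the same
element of the fibre because the expression is `Spin(n)`-equivariant. -/
def hiddenSpinor (ψ : P.Spinor σ) : P.Spinor σ := fun x => σ.hidden (ψ x)

end SpinStructure

end Geometry

end

open Bundle Set Manifold
open scoped ContDiff InnerProductSpace

/-! The spinor φ is a cubic polynomial in ψ, computed in each fibre, and the theorem is an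
equivariance property of this polynomial `hidden`. The operators e_l e_m (l < m), 𝐢 e₀, e_l e₀ and 𝐢
e_l span the image of a representation of so(n,2), skew for the indefinite form ⟨e₀ ·, ·⟩. Up to the
factor -𝐢, `hidden p` is the sum of ε_A Im⟨e₀ A p, p⟩ A p over these generators A, with ε_A = 1 for
the compact ones e_l e_m, 𝐢 e₀ and ε_A = -1 for the others. This is the moment map of p, carried
into the Lie algebra by its invariant form and applied to p, so it commutes with the algebra.

Only the generators that enter the equation and the connection are needed: `dhidden_boost` for e_l
e₀, `dhidden_imag` for 𝐢 e_l and `dhidden_rotation` for e_l e_m, each checked from the Clifford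
relations. In a trivialization ∇ = ∂ + Ω with Ω in the span of the rotations, so the chain rule
gives ∇φ = `dhidden ψ (∇ψ)`, and the right side of the Killing equation passes through `dhidden`.

Equivariance under the group Spin(n) itself (`hidden_diag`) shows that φ is represented by `hidden`
of the representative of ψ in every trivialization. This yields the regularity and justifies
differentiating near a point. -/

noncomputable section

/-! ### Cubic expressions and the Clifford relations on S ⊕ S -/

namespace SpinorModule

variable {n : ℕ} {S : Type*} [NormedAddCommGroup S] [InnerProductSpace ℂ S]

/-- The cubic expression `Re ⟨T p, p⟩ U p`, as a real bilinear map in the operators `T`, `U`. -/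
def quad (p : Dbl S) :
    Module.End ℂ (Dbl S) →ₗ[ℝ] Module.End ℂ (Dbl S) →ₗ[ℝ] Dbl S :=
  LinearMap.mk₂ ℝ (fun T U => (herm (T p) p).re • U p)
    (fun T T' U => by simp [herm, add_smul])
    (fun c T U => by simp [herm, ← mul_add, mul_smul])
    (fun T U U' => by simp)
    (fun c T U => by simp [smul_comm c])

lemma quad_apply (p : Dbl S) (T U : Module.End ℂ (Dbl S)) :
    quad p T U = (herm (T p) p).re • U p := rfl

/-- The derivative of `p ↦ quad p T U` in the direction `q`. -/
def dquad (T U : Module.End ℂ (Dbl S)) (p q : Dbl S) : Dbl S :=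
  (herm (T q) p + herm (T p) q).re • U p + (herm (T p) p).re • U q

/-- Along a linear vector field p ↦ A p the derivative of a `quad` is again a sum of `quad` terms,
because A moves across the Hermitian product. Infinitesimal equivariance thus becomes an identity
between operator words. -/
lemma dquad_apply_of_adjoint {A A' : Module.End ℂ (Dbl S)}
    (hA : ∀ a b, herm a (A b) = herm (A' a) b) (T U : Module.End ℂ (Dbl S)) (p : Dbl S) :
    dquad T U p (A p) = quad p (T * A + A' * T) U + quad p T (U * A) := by
  simp only [dquad, quad_apply, hA, Module.End.mul_apply, LinearMap.map_add,
    LinearMap.add_apply]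
  simp only [herm, Complex.add_re, add_smul]

lemma apply_quad (A T U : Module.End ℂ (Dbl S)) (p : Dbl S) :
    A (quad p T U) = quad p T (A * U) := by
  simp [quad_apply]

lemma quad_map_of_isometry {s s' : Module.End ℂ (Dbl S)}
    (hs : ∀ a b, herm a (s b) = herm (s' a) b)
    (T U : Module.End ℂ (Dbl S)) (p : Dbl S) :
    quad (s p) T U = quad p (s' * T * s) (U * s) := by
  simp [quad_apply, hs]

variable (σ : SpinorModule n S)

lemma e0_apply (p : Dbl S) : e0 p = WithLp.toLp 2 (p.snd, p.fst) := rfl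

lemma cl_apply (v : EucSp n) (p : Dbl S) :
    σ.cl v p = WithLp.toLp 2 (σ.rep (clι n v) p.fst, -σ.rep (clι n v) p.snd) := rfl

lemma herm_e0 (a b : Dbl S) : herm a (e0 b) = herm (e0 a) b := by
  simp [herm, e0_apply, WithLp.prod_inner_apply, add_comm]

lemma herm_cl (v : EucSp n) (a b : Dbl S) : herm a (σ.cl v b) = -herm (σ.cl v a) b := by
  simp [herm, cl, dblMap, WithLp.prod_inner_apply, σ.skew, add_comm]

lemma herm_e (i : Fin n) (a b : Dbl S) : herm a (σ.e i b) = -herm (σ.e i a) b :=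
  σ.herm_cl _ a b

lemma e0_mul_e0 : (e0 * e0 : Module.End ℂ (Dbl S)) = 1 := rfl

lemma cl_mul_e0 (v : EucSp n) : σ.cl v * e0 = -(e0 * σ.cl v) := by
  ext p
  refine WithLp.ofLp_injective 2 (Prod.ext ?_ ?_) <;> simp [cl_apply, e0_apply]

lemma e_mul_e0 (i : Fin n) : σ.e i * e0 = -(e0 * σ.e i) := σ.cl_mul_e0 _

lemma cl_add (v w : EucSp n) : σ.cl (v + w) = σ.cl v + σ.cl w := by
  have h : σ.rep (clι n (v + w)) = σ.rep (clι n v) + σ.rep (clι n w) := by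
    rw [LinearMap.map_add (clι n) v w, map_add]
  ext p
  rw [LinearMap.add_apply, cl_apply, cl_apply, cl_apply, h]
  refine WithLp.ofLp_injective 2 (Prod.ext rfl ?_)
  exact neg_add _ _

lemma cl_smul (c : ℝ) (v : EucSp n) : σ.cl (c • v) = c • σ.cl v := by
  have h : σ.rep (clι n (c • v)) = c • σ.rep (clι n v) := by
    rw [LinearMap.map_smul (clι n) c v]
    exact map_smul σ.rep c _
  ext p
  rw [LinearMap.smul_apply, cl_apply, cl_apply, h]
  refine WithLp.ofLp_injective 2 (Prod.ext rfl ?_)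
  exact (smul_neg c _).symm

/-- Clifford multiplication on `S ⊕ S` as a linear map. -/
def clLin : EucSp n →ₗ[ℝ] Module.End ℂ (Dbl S) where
  toFun := σ.cl
  map_add' := σ.cl_add
  map_smul' := σ.cl_smul

lemma cl_eq_sum (v : EucSp n) : σ.cl v = ∑ i, v i • σ.e i := by
  have hv : v = ∑ i, v i • EuclideanSpace.single i (1 : ℝ) := by
    simpa using ((EuclideanSpace.basisFun (Fin n) ℝ).sum_repr v).symm
  change σ.clLin v = ∑ i, v i • σ.clLin (EuclideanSpace.single i 1)
  conv_lhs => rw [hv, map_sum]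
  exact Finset.sum_congr rfl fun i _ => LinearMap.map_smul _ _ _

lemma e_mul_e (i j : Fin n) :
    σ.e i * σ.e j = -(σ.e j * σ.e i) - (if i = j then 2 else 0 : ℝ) • 1 := by
  have h : clι n (EuclideanSpace.single i 1) * clι n (EuclideanSpace.single j 1) =
      -(clι n (EuclideanSpace.single j 1) * clι n (EuclideanSpace.single i 1))
        - algebraMap ℝ (Cl n) (if i = j then 2 else 0) := by
    have h := CliffordAlgebra.ι_mul_ι_add_swap (Q := negForm n)
      (EuclideanSpace.single i 1) (EuclideanSpace.single j 1)
    have hp : QuadraticMap.polar (negForm n) (EuclideanSpace.single i 1)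
        (EuclideanSpace.single j 1) = -(if i = j then 2 else 0) := by
      rw [negForm, FunLike.coe_neg, QuadraticMap.polar_neg,
        LinearMap.BilinMap.polar_toQuadraticMap]
      simp only [innerₗ_apply_apply, EuclideanSpace.inner_single_left]
      by_cases hij : i = j
      · subst hij; norm_num
      · simp [hij, Ne.symm hij]
    rw [hp, map_neg] at h
    rw [eq_sub_iff_add_eq, eq_neg_iff_add_eq_zero, add_right_comm, h, neg_add_cancel]
  have h' := congrArg σ.rep h
  simp only [map_mul, map_sub, map_neg, AlgHom.commutes] at h'
  ext p
  rw [LinearMap.sub_apply, LinearMap.smul_apply]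
  have h₁ := LinearMap.congr_fun h' p.fst
  have h₂ := LinearMap.congr_fun h' p.snd
  refine WithLp.ofLp_injective 2 (Prod.ext ?_ ?_)
  · simpa [e, cl_apply, Module.algebraMap_end_apply, -ite_smul] using h₁
  · simpa [e, cl_apply, Module.algebraMap_end_apply, -ite_smul] using h₂

lemma herm_one_re (p : Dbl S) : N p = (herm ((1 : Module.End ℂ (Dbl S)) p) p).re := by
  simp [N, herm, inner_self_eq_norm_sq_to_K, ← Complex.ofReal_pow]

/-- All four terms become real parts times operators, so that one calculus covers them. The outer e₀
cancels the inner one in the X and ω terms, and Im z = -Re(𝐢 z) turns the sign of the ω term into a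
plus. -/
lemma hidden_eq (p : Dbl S) : σ.hidden p = quad p 1 e0
    - ∑ i, quad p (Complex.I • σ.e i) (Complex.I • (e0 * σ.e i))
    + ∑ i, quad p (σ.e i * e0) (σ.e i)
    + (1 / 2 : ℝ) • ∑ i, ∑ j, quad p (Complex.I • (σ.e i * σ.e j * e0))
        (Complex.I • (σ.e i * σ.e j)) := by
  have hN : (N p : ℂ) • e0 p = quad p 1 e0 := by
    rw [herm_one_re, quad_apply, Complex.coe_smul]
  have hY : Complex.I • e0 (σ.cl (σ.Y p) p)
      = ∑ i, quad p (Complex.I • σ.e i) (Complex.I • (e0 * σ.e i)) := by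
    simp [cl_eq_sum, quad_apply, Y, Finset.smul_sum, smul_comm Complex.I]
  have hX : σ.cl (σ.X p) p = ∑ i, quad p (σ.e i * e0) (σ.e i) := by
    simp [cl_eq_sum, quad_apply, X]
  have hω : Complex.I • σ.clom p p = -∑ i, ∑ j,
      quad p (Complex.I • (σ.e i * σ.e j * e0)) (Complex.I • (σ.e i * σ.e j)) := by
    simp only [clom, LinearMap.sum_apply, Finset.smul_sum, ← Finset.sum_neg_distrib]
    refine Finset.sum_congr rfl fun i _ => Finset.sum_congr rfl fun j _ => ?_
    have hre (z : ℂ) : z.im = -(Complex.I * z).re := by simp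
    rw [LinearMap.smul_apply, Complex.coe_smul, smul_comm, quad_apply, om, hre, herm, herm,
      ← inner_smul_right, neg_smul]
    rfl
  have h0 (q : Dbl S) : e0 (e0 q) = q := rfl
  have hhalf (q : Dbl S) : (Complex.I / 2) • q = (1 / 2 : ℝ) • Complex.I • q := by
    rw [← Complex.coe_smul, smul_smul]
    congr 1
    push_cast
    ring
  rw [← hN, ← hY, ← hX, ← neg_neg (Finset.sum _ _), ← hω, smul_neg, ← hhalf]
  simp [hidden, h0, sub_eq_add_neg]

end SpinorModule

/-! ### Infinitesimal equivariance of the cubic map -/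

namespace SpinorModule

variable {n : ℕ} {S : Type*} [NormedAddCommGroup S] [InnerProductSpace ℂ S]
variable (σ : SpinorModule n S)

/-- The derivative of `hidden` at `p` in the direction `q`. -/
def dhidden (p q : Dbl S) : Dbl S := dquad 1 e0 p q
    - ∑ i, dquad (Complex.I • σ.e i) (Complex.I • (e0 * σ.e i)) p q
    + ∑ i, dquad (σ.e i * e0) (σ.e i) p q
    + (1 / 2 : ℝ) • ∑ i, ∑ j, dquad (Complex.I • (σ.e i * σ.e j * e0))
        (Complex.I • (σ.e i * σ.e j)) p q

lemma dquad_add (T U : Module.End ℂ (Dbl S)) (p q q' : Dbl S) :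
    dquad T U p (q + q') = dquad T U p q + dquad T U p q' := by
  simp only [dquad, herm, map_add, inner_add_left, inner_add_right, Complex.add_re]
  module

lemma dquad_smul (T U : Module.End ℂ (Dbl S)) (p : Dbl S) (c : ℝ) (q : Dbl S) :
    dquad T U p (c • q) = c • dquad T U p q := by
  have h : herm (T (c • q)) p + herm (T p) (c • q) = (c : ℂ) * (herm (T q) p + herm (T p) q) := by
    rw [← Complex.coe_smul c q, map_smul, herm, herm, inner_smul_left, inner_smul_right,
      Complex.conj_ofReal, mul_add]
    rfl
  rw [dquad, h, Complex.re_ofReal_mul, dquad]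
  rw [← Complex.coe_smul c q, map_smul, Complex.coe_smul]
  module

lemma dhidden_add (p q q' : Dbl S) :
    σ.dhidden p (q + q') = σ.dhidden p q + σ.dhidden p q' := by
  simp only [dhidden, dquad_add, Finset.sum_add_distrib]
  module

lemma dhidden_smul (p : Dbl S) (c : ℝ) (q : Dbl S) :
    σ.dhidden p (c • q) = c • σ.dhidden p q := by
  simp only [dhidden, dquad_smul, ← Finset.smul_sum]
  module

/-- `σ.dhidden p` as a linear map. -/
def dhiddenLin (p : Dbl S) : Dbl S →ₗ[ℝ] Dbl S where
  toFun := σ.dhidden p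
  map_add' := σ.dhidden_add p
  map_smul' := σ.dhidden_smul p

lemma dhidden_boost (p : Dbl S) (l : Fin n) :
    σ.dhidden p ((σ.e l * e0 : Module.End ℂ (Dbl S)) p) =
      (σ.e l * e0 : Module.End ℂ (Dbl S)) (σ.hidden p) := by
  have hA (a b : Dbl S) : herm a ((σ.e l * e0 : Module.End ℂ (Dbl S)) b) =
      herm ((σ.e l * e0 : Module.End ℂ (Dbl S)) a) b := by
    rw [Module.End.mul_apply, herm_e, herm_e0, ← Module.End.mul_apply, ← neg_eq_iff_eq_neg.2
      (σ.e_mul_e0 l)]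
    simp [herm]
  -- The Kronecker term 2δ_il is kept as an opaque weight, so that it can be pulled out of products
  -- before `hsum` collapses the sum.
  obtain ⟨d, hd⟩ : ∃ d : Fin n → ℝ, d = fun i => if i = l then 2 else 0 := ⟨_, rfl⟩
  have hsum (F : Fin n → Dbl S) : ∑ i, d i • F i = (2 : ℝ) • F l := by simp [hd]
  have he (i : Fin n) : σ.e i * σ.e l = -(σ.e l * σ.e i) - d i • 1 := by
    rw [hd]; exact σ.e_mul_e i l
  have h0 (T : Module.End ℂ (Dbl S)) : T * e0 * e0 = T := by rw [mul_assoc, e0_mul_e0, mul_one]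
  have hx (T : Module.End ℂ (Dbl S)) (i : Fin n) : T * e0 * σ.e i = -(T * σ.e i * e0) := by
    rw [mul_assoc, mul_assoc, e_mul_e0, mul_neg, neg_neg]
  have hl (T : Module.End ℂ (Dbl S)) (i : Fin n) : T * σ.e i * σ.e l =
      -(T * σ.e l * σ.e i) - d i • T := by
    rw [mul_assoc, he]; simp [mul_sub, mul_assoc]
  have hx' (i : Fin n) : e0 * σ.e i = -(σ.e i * e0) := by
    rw [e_mul_e0, neg_neg]
  have hI (c : ℂ) (i : Fin n) (T : Module.End ℂ (Dbl S)) : c • d i • T = d i • c • T :=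
    smul_comm _ _ _
  rw [hidden_eq, dhidden]
  simp only [dquad_apply_of_adjoint hA, map_add, map_sub, map_sum, apply_quad,
    LinearMap.map_smul_of_tower]
  -- Normal form of words: e_l moves left past the summed e_i, and e₀ moves to the far right. The
  -- contraction terms left by the Clifford relation cancel between neighbouring pieces of `hidden`.
  simp only [map_sub, map_neg, one_mul,
    mul_one, smul_mul_assoc, mul_smul_comm, ← mul_assoc, h0, hx, hl, he, e0_mul_e0, hx',
    neg_mul, mul_neg, neg_neg, smul_neg, smul_sub, neg_sub, sub_mul, hI, map_smul,
    LinearMap.add_apply, LinearMap.sub_apply, LinearMap.neg_apply, LinearMap.smul_apply, smul_add,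
    Finset.sum_add_distrib, Finset.sum_sub_distrib, Finset.sum_neg_distrib, hsum,
    ← Finset.smul_sum]
  module

lemma dhidden_imag (p : Dbl S) (l : Fin n) :
    σ.dhidden p ((Complex.I • σ.e l : Module.End ℂ (Dbl S)) p) =
      (Complex.I • σ.e l : Module.End ℂ (Dbl S)) (σ.hidden p) := by
  have hA (a b : Dbl S) : herm a ((Complex.I • σ.e l : Module.End ℂ (Dbl S)) b) =
      herm ((Complex.I • σ.e l : Module.End ℂ (Dbl S)) a) b := by
    have h := σ.herm_e l a b
    rw [herm] at h
    rw [LinearMap.smul_apply, LinearMap.smul_apply, herm, herm, inner_smul_left,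
      inner_smul_right, h, Complex.conj_I, neg_mul, mul_neg, neg_neg]
    rfl
  obtain ⟨d, hd⟩ : ∃ d : Fin n → ℝ, d = fun i => if i = l then 2 else 0 := ⟨_, rfl⟩
  have hsum (F : Fin n → Dbl S) : ∑ i, d i • F i = (2 : ℝ) • F l := by simp [hd]
  have he (i : Fin n) : σ.e i * σ.e l = -(σ.e l * σ.e i) - d i • 1 := by
    rw [hd]; exact σ.e_mul_e i l
  have hx (T : Module.End ℂ (Dbl S)) (i : Fin n) : T * e0 * σ.e i = -(T * σ.e i * e0) := by
    rw [mul_assoc, mul_assoc, e_mul_e0, mul_neg, neg_neg]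
  have hl (T : Module.End ℂ (Dbl S)) (i : Fin n) : T * σ.e i * σ.e l =
      -(T * σ.e l * σ.e i) - d i • T := by
    rw [mul_assoc, he]; simp [mul_sub, mul_assoc]
  have hx' (i : Fin n) : e0 * σ.e i = -(σ.e i * e0) := by
    rw [e_mul_e0, neg_neg]
  have hI (c : ℂ) (i : Fin n) (T : Module.End ℂ (Dbl S)) : c • d i • T = d i • c • T :=
    smul_comm _ _ _
  have hII (T : Module.End ℂ (Dbl S)) : Complex.I • Complex.I • T = -T := by
    rw [smul_smul, Complex.I_mul_I, neg_one_smul]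
  rw [hidden_eq, dhidden]
  simp only [dquad_apply_of_adjoint hA, map_add, map_sub, map_sum, apply_quad,
    LinearMap.map_smul_of_tower]
  simp only [map_sub, map_neg, one_mul,
    mul_one, smul_mul_assoc, mul_smul_comm, ← mul_assoc, hx, hl, he, hx', hII,
    neg_mul, mul_neg, neg_neg, smul_neg, smul_sub, neg_sub, sub_mul, hI, map_smul,
    LinearMap.add_apply, LinearMap.sub_apply, LinearMap.neg_apply, LinearMap.smul_apply, smul_add,
    Finset.sum_add_distrib, Finset.sum_sub_distrib, Finset.sum_neg_distrib, hsum,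
    ← Finset.smul_sum]
  module

/-- The commutator with e_l e_m rotates the vectors e_i infinitesimally, and each sum in `hidden` is
rotation invariant. The case l = m must be excluded: e_l e_l = -1, and the derivative of a cubic map
at p along -p is -3 times its value. -/
lemma dhidden_rotation (p : Dbl S) {l m : Fin n} (hlm : l ≠ m) :
    σ.dhidden p ((σ.e l * σ.e m : Module.End ℂ (Dbl S)) p) =
      (σ.e l * σ.e m : Module.End ℂ (Dbl S)) (σ.hidden p) := by
  obtain ⟨D, hD⟩ : ∃ D, D = σ.e l * σ.e m := ⟨_, rfl⟩
  have hD' : σ.e m * σ.e l = -D := by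
    rw [hD, σ.e_mul_e m l]; simp [hlm.symm]
  have hA (a b : Dbl S) : herm a (D b) = herm ((-D) a) b := by
    rw [← hD', hD, Module.End.mul_apply, Module.End.mul_apply, herm_e, herm_e, neg_neg]
  obtain ⟨d, hd⟩ : ∃ d : Fin n → ℝ, d = fun i => if i = l then 2 else 0 := ⟨_, rfl⟩
  obtain ⟨d', hd'⟩ : ∃ d : Fin n → ℝ, d = fun i => if i = m then 2 else 0 := ⟨_, rfl⟩
  have hsum (F : Fin n → Dbl S) : ∑ i, d i • F i = (2 : ℝ) • F l := by simp [hd]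
  have hsum' (F : Fin n → Dbl S) : ∑ i, d' i • F i = (2 : ℝ) • F m := by simp [hd']
  -- The infinitesimal rotation: [e_i, D] = -2δ_il e_m + 2δ_im e_l.
  have he (i : Fin n) : σ.e i * D = D * σ.e i - d i • σ.e m + d' i • σ.e l := by
    have h := σ.e_mul_e i l
    have h' := σ.e_mul_e i m
    rw [hD, hd, hd', ← mul_assoc, h, sub_mul, neg_mul, mul_assoc, h']
    simp only [mul_sub, mul_neg, smul_mul_assoc, one_mul, mul_smul_comm, mul_one, mul_assoc]
    abel
  have h0 : e0 * D = D * e0 := by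
    rw [hD, mul_assoc, e_mul_e0, mul_neg, ← mul_assoc, ← mul_assoc, e_mul_e0, neg_mul, neg_neg]
  have h0' (T : Module.End ℂ (Dbl S)) : T * e0 * D = T * D * e0 := by
    rw [mul_assoc, h0, mul_assoc]
  have hl (T : Module.End ℂ (Dbl S)) (i : Fin n) : T * σ.e i * D =
      T * D * σ.e i - d i • (T * σ.e m) + d' i • (T * σ.e l) := by
    rw [mul_assoc, he]; simp [mul_sub, mul_add, mul_assoc]
  have hI (c : ℂ) (i : Fin n) (T : Module.End ℂ (Dbl S)) : c • d i • T = d i • c • T :=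
    smul_comm _ _ _
  have hI' (c : ℂ) (i : Fin n) (T : Module.End ℂ (Dbl S)) : c • d' i • T = d' i • c • T :=
    smul_comm _ _ _
  rw [hidden_eq, dhidden, ← hD]
  simp only [dquad_apply_of_adjoint hA, map_add, map_sub, map_sum, apply_quad,
    LinearMap.map_smul_of_tower]
  simp only [map_add, map_sub, map_neg, one_mul,
    mul_one, smul_mul_assoc, mul_smul_comm, ← mul_assoc, h0, h0', hl, he,
    neg_mul, smul_neg, smul_sub, add_mul, sub_mul, hI, hI', map_smul,
    LinearMap.add_apply, LinearMap.sub_apply, LinearMap.neg_apply, LinearMap.smul_apply, smul_add,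
    Finset.sum_add_distrib, Finset.sum_sub_distrib, Finset.sum_neg_distrib, hsum, hsum',
    ← Finset.smul_sum]
  module

end SpinorModule

/-! ### Equivariance under unitary rotations; smoothness and derivative -/

namespace SpinorModule

variable {n : ℕ} {S : Type*} [NormedAddCommGroup S] [InnerProductSpace ℂ S]
variable (σ : SpinorModule n S)

lemma sum_sum_comm {V : Type*} [AddCommMonoid V] (f : Fin n → Fin n → Fin n → Fin n → V) :
    ∑ i, ∑ j, ∑ k, ∑ l, f i j k l = ∑ k, ∑ l, ∑ i, ∑ j, f i j k l := by
  have h := Finset.sum_comm (s := Finset.univ) (t := Finset.univ)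
    (f := fun x y : Fin n × Fin n => f x.1 x.2 y.1 y.2)
  simpa only [Fintype.sum_prod_type] using h

/-- Conjugation by s puts a factor R on each index in the first slot of `quad`. Exchanging the sums
moves both factors to the second slot, where they are exactly what it takes to pull s out to the
left. -/
lemma quad_twoForm_map {s s' : Module.End ℂ (Dbl S)} (hs : ∀ a b, herm a (s b) = herm (s' a) b)
    (hss' : s * s' = 1) (h0 : s * e0 = e0 * s) {R : Fin n → Fin n → ℝ}
    (hR : ∀ i, s * σ.e i = ∑ j, R i j • (σ.e j * s))
    (hR' : ∀ j, s' * σ.e j * s = ∑ i, R i j • σ.e i) (p : Dbl S) :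
    ∑ i, ∑ j, quad (s p) (Complex.I • (σ.e i * σ.e j * e0)) (Complex.I • (σ.e i * σ.e j)) =
      s (∑ i, ∑ j, quad p (Complex.I • (σ.e i * σ.e j * e0)) (Complex.I • (σ.e i * σ.e j))) := by
  have hI (c : ℝ) (T : Module.End ℂ (Dbl S)) : Complex.I • c • T = c • Complex.I • T :=
    smul_comm _ _ _
  have h (i j : Fin n) : s' * (σ.e i * σ.e j * e0) * s =
      ∑ k, ∑ l, R k i • R l j • (σ.e k * σ.e l * e0) := by
    calc s' * (σ.e i * σ.e j * e0) * s
        = (s' * σ.e i * s) * (s' * σ.e j * s) * e0 := by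
          simp only [mul_assoc, ← h0]
          -- Inserting s s' = 1 between the two vectors lets each be conjugated separately.
          rw [← mul_assoc s s', hss', one_mul]
      _ = _ := by
          rw [hR', hR', Finset.sum_mul_sum, Finset.sum_mul]
          simp only [Finset.sum_mul, smul_mul_assoc, mul_smul_comm]
          exact Finset.sum_congr rfl fun k _ => Finset.sum_congr rfl fun l _ => smul_comm _ _ _
  have h' (k l : Fin n) : s * (σ.e k * σ.e l) =
      ∑ i, ∑ j, R k i • R l j • (σ.e i * σ.e j * s) := by
    rw [← mul_assoc, hR, Finset.sum_mul]
    simp only [smul_mul_assoc, mul_assoc, hR, Finset.mul_sum, mul_smul_comm, Finset.smul_sum]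
  simp only [map_sum, apply_quad, quad_map_of_isometry hs, h, h', mul_smul_comm,
    smul_mul_assoc, Finset.smul_sum, hI, LinearMap.sum_apply,
    LinearMap.smul_apply, map_smul]
  exact sum_sum_comm fun i j k l => R k i • R l j •
    quad p (Complex.I • (σ.e k * σ.e l * e0)) (Complex.I • (σ.e i * σ.e j * s))

/-- `hidden` commutes with every unitary operator that commutes with `e₀` and rotates the
Clifford vectors. -/
lemma hidden_map {s s' : Module.End ℂ (Dbl S)} (hs : ∀ a b, herm a (s b) = herm (s' a) b)
    (hss' : s * s' = 1) (hs's : s' * s = 1) (h0 : s * e0 = e0 * s) {R : Fin n → Fin n → ℝ}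
    (hR : ∀ i, s * σ.e i = ∑ j, R i j • (σ.e j * s))
    (hR' : ∀ j, s' * σ.e j * s = ∑ i, R i j • σ.e i) (p : Dbl S) :
    σ.hidden (s p) = s (σ.hidden p) := by
  have hI (c : ℝ) (T : Module.End ℂ (Dbl S)) : Complex.I • c • T = c • Complex.I • T :=
    smul_comm _ _ _
  have hY : ∑ i, quad (s p) (Complex.I • σ.e i) (Complex.I • (e0 * σ.e i)) =
      s (∑ i, quad p (Complex.I • σ.e i) (Complex.I • (e0 * σ.e i))) := by
    simp only [map_sum, apply_quad, quad_map_of_isometry hs, mul_smul_comm, smul_mul_assoc,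
      ← mul_assoc, hR', h0, mul_assoc e0 s, hR, Finset.smul_sum, Finset.mul_sum,
      LinearMap.sum_apply, LinearMap.smul_apply, map_smul, hI]
    exact Finset.sum_comm
  have hX : ∑ i, quad (s p) (σ.e i * e0) (σ.e i) = s (∑ i, quad p (σ.e i * e0) (σ.e i)) := by
    have h (i : Fin n) : s' * (σ.e i * e0) * s = ∑ j, R j i • (σ.e j * e0) := by
      rw [mul_assoc, mul_assoc, ← h0, ← mul_assoc, ← mul_assoc, hR', Finset.sum_mul]
      simp only [smul_mul_assoc]
    simp only [map_sum, apply_quad, quad_map_of_isometry hs, h, hR,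
      LinearMap.sum_apply, LinearMap.smul_apply, map_smul]
    exact Finset.sum_comm
  rw [hidden_eq, hidden_eq, hY, hX, σ.quad_twoForm_map hs hss' h0 hR hR', map_add, map_add,
    map_sub, LinearMap.map_smul_of_tower, apply_quad, quad_map_of_isometry hs, mul_one, hs's, h0]

lemma hasDerivAt_quad [FiniteDimensional ℂ S] (T U : Module.End ℂ (Dbl S)) {c : ℝ → Dbl S}
    {c' : Dbl S} {t : ℝ} (hc : HasDerivAt c c' t) :
    HasDerivAt (fun t => quad (c t) T U) (dquad T U (c t) c') t := by
  have hl (A : Module.End ℂ (Dbl S)) : HasDerivAt (fun t => A (c t)) (A c') t :=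
    ((LinearMap.toContinuousLinearMap A).restrictScalars ℝ).hasFDerivAt.comp_hasDerivAt t hc
  have h : HasDerivAt (fun t => herm (T (c t)) (c t)) (herm (T c') (c t) + herm (T (c t)) c') t := by
    have := hc.inner ℂ (hl T)
    exact (add_comm _ _ : herm (T c') (c t) + herm (T (c t)) c' = _) ▸ this
  have h' := (Complex.reCLM.hasFDerivAt.comp_hasDerivAt t h).smul (hl U)
  rw [add_comm] at h'
  exact h'

lemma contDiff_quad [FiniteDimensional ℂ S] (T U : Module.End ℂ (Dbl S)) :
    ContDiff ℝ ∞ (fun p => quad p T U) := by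
  have hl (A : Module.End ℂ (Dbl S)) : ContDiff ℝ ∞ (fun p => A p) :=
    ((LinearMap.toContinuousLinearMap A).restrictScalars ℝ).contDiff
  exact (Complex.reCLM.contDiff.comp (contDiff_id.inner ℂ (hl T))).smul (hl U)

lemma contDiff_hidden [FiniteDimensional ℂ S] : ContDiff ℝ ∞ σ.hidden := by
  rw [funext σ.hidden_eq]
  exact (((contDiff_quad _ _).sub (ContDiff.sum fun i _ => contDiff_quad _ _)).add
    (ContDiff.sum fun i _ => contDiff_quad _ _)).add
    ((ContDiff.sum fun i _ => ContDiff.sum fun j _ => contDiff_quad _ _).const_smul (1 / 2 : ℝ))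

/-- Both sides are the derivative at t = 0 of `hidden` along the line p + t q. -/
lemma fderiv_hidden_apply [FiniteDimensional ℂ S] (p q : Dbl S) :
    fderiv ℝ σ.hidden p q = σ.dhidden p q := by
  have hc : HasDerivAt (fun t : ℝ => p + t • q) q 0 := by
    simpa using ((hasDerivAt_id (0 : ℝ)).smul_const q).const_add p
  have h0 : p + (0 : ℝ) • q = p := by simp
  have h₁ : HasDerivAt (fun t : ℝ => σ.hidden (p + t • q)) (σ.dhidden p q) 0 := by
    rw [funext fun t : ℝ => σ.hidden_eq (p + t • q), dhidden]
    have hq (T U : Module.End ℂ (Dbl S)) := hasDerivAt_quad T U hc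
    simp only [h0] at hq
    exact (((hq _ _).fun_sub (HasDerivAt.fun_sum fun i _ => hq _ _)).fun_add
      (HasDerivAt.fun_sum fun i _ => hq _ _)).fun_add
      ((HasDerivAt.fun_sum fun i _ => HasDerivAt.fun_sum fun j _ => hq _ _).fun_const_smul
        (1 / 2 : ℝ))
  have h₂ : HasDerivAt (fun t : ℝ => σ.hidden (p + t • q)) (fderiv ℝ σ.hidden p q) 0 := by
    have hd : HasFDerivAt σ.hidden (fderiv ℝ σ.hidden p) (p + (0 : ℝ) • q) := by
      rw [h0]
      exact (σ.contDiff_hidden.differentiable (by simp) p).hasFDerivAt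
    exact hd.comp_hasDerivAt (0 : ℝ) hc
  exact h₂.unique h₁

end SpinorModule

/-! ### The actions of Spin(n) and of the Killing operators -/

namespace SpinorModule

variable {n : ℕ} {S : Type*} [NormedAddCommGroup S] [InnerProductSpace ℂ S]
variable (σ : SpinorModule n S)

/-- The star of Cl(n) is the anti-automorphism that negates vectors, so skewness on vectors
propagates to all products. On the spin group star is the inverse, hence that group acts unitarily.
-/
lemma inner_rep (x : Cl n) (a b : S) : ⟪σ.rep x a, b⟫_ℂ = ⟪a, σ.rep (star x) b⟫_ℂ := by
  induction x using CliffordAlgebra.induction generalizing a b with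
  | algebraMap r =>
    rw [CliffordAlgebra.star_algebraMap, AlgHom.commutes, Module.algebraMap_end_apply,
      Module.algebraMap_end_apply, ← Complex.coe_smul, ← Complex.coe_smul, inner_smul_left,
      inner_smul_right, Complex.conj_ofReal]
  | ι v =>
    have := σ.skew v a b
    rw [CliffordAlgebra.star_ι, map_neg, LinearMap.neg_apply, inner_neg_right]
    exact this
  | mul x y hx hy =>
    rw [star_mul, map_mul, map_mul, Module.End.mul_apply, Module.End.mul_apply, hx, hy]
  | add x y hx hy =>
    rw [star_add, map_add, map_add, LinearMap.add_apply, LinearMap.add_apply, inner_add_left,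
      inner_add_right, hx, hy]

/-- The diagonal action of `Cl(n)` on `S ⊕ S`. -/
def diag (x : Cl n) : Module.End ℂ (Dbl S) := dblMap (σ.rep x) (σ.rep x)

lemma diag_mul (x y : Cl n) : σ.diag (x * y) = σ.diag x * σ.diag y := by
  rw [diag, map_mul]; rfl

lemma diag_one : σ.diag 1 = 1 := by
  rw [diag, map_one]; rfl

lemma herm_diag (x : Cl n) (a b : Dbl S) : herm a (σ.diag x b) = herm (σ.diag (star x) a) b := by
  rw [herm, herm, WithLp.prod_inner_apply, WithLp.prod_inner_apply]
  exact congrArg₂ (· + ·) (σ.inner_rep x _ _) (σ.inner_rep x _ _)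

lemma diag_mul_e0 (x : Cl n) : σ.diag x * e0 = e0 * σ.diag x := rfl

lemma diag_mul_cl {x : Cl n} {v w : EucSp n} (h : clι n v * x = x * clι n w) :
    σ.diag x * σ.cl w = σ.cl v * σ.diag x := by
  have h' := congrArg σ.rep h
  rw [map_mul, map_mul] at h'
  rw [diag, cl, cl, dblMap_mul, dblMap_mul, h', neg_mul, h', mul_neg]

lemma diag_e_mul_e (j k : Fin n) :
    σ.diag (clι n (EuclideanSpace.single j 1) * clι n (EuclideanSpace.single k 1)) =
      σ.e j * σ.e k := by
  rw [diag, e, e, cl, cl, dblMap_mul, neg_mul_neg, map_mul]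

lemma hidden_diag {x : Cl n} (hx : x ∈ spinGroup (negForm n)) {R : Matrix (Fin n) (Fin n) ℝ}
    (hR : R * R.transpose = 1)
    (h : ∀ i, clι n (WithLp.toLp 2 (R i)) * x = x * clι n (EuclideanSpace.single i 1))
    (p : Dbl S) : σ.hidden (σ.diag x p) = σ.diag x (σ.hidden p) := by
  have h₁ : σ.diag (star x) * σ.diag x = 1 := by
    rw [← diag_mul, spinGroup.star_mul_self_of_mem hx, diag_one]
  have h₂ : σ.diag x * σ.diag (star x) = 1 := by
    rw [← diag_mul, spinGroup.mul_star_self_of_mem hx, diag_one]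
  have h₃ (i : Fin n) : σ.diag x * σ.e i = ∑ j, R i j • (σ.e j * σ.diag x) := by
    rw [e, diag_mul_cl σ (h i), cl_eq_sum, Finset.sum_mul]
    simp only [smul_mul_assoc]
  have hR' : R.transpose * R = 1 := mul_eq_one_comm.1 hR
  -- Inverts `h₃` using the orthonormality of the columns of R.
  have h₄ (j : Fin n) : σ.e j * σ.diag x = ∑ i, R i j • (σ.diag x * σ.e i) := by
    simp only [h₃, Finset.smul_sum, smul_smul]
    rw [Finset.sum_comm]
    simp only [← Finset.sum_smul]
    have hjk (k : Fin n) : ∑ i, R i j * R i k = if j = k then 1 else 0 := by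
      have := congrFun (congrFun hR' j) k
      rwa [Matrix.mul_apply, Matrix.one_apply] at this
    simp [hjk]
  refine σ.hidden_map (σ.herm_diag x) h₂ h₁ (σ.diag_mul_e0 x) h₃ (fun j => ?_) p
  rw [mul_assoc, h₄, Finset.mul_sum]
  simp only [mul_smul_comm, ← mul_assoc, h₁, one_mul]

/-- Derivative of `hidden` along the infinitesimal spin action. -/
lemma dhidden_diag (c : Fin n → Fin n → ℝ) (hc : ∀ j k, c j k = -c k j) (p : Dbl S) :
    σ.dhidden p (σ.diag (∑ j, ∑ k, c j k •
      (clι n (EuclideanSpace.single j 1) * clι n (EuclideanSpace.single k 1))) p) =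
    σ.diag (∑ j, ∑ k, c j k •
      (clι n (EuclideanSpace.single j 1) * clι n (EuclideanSpace.single k 1))) (σ.hidden p) := by
  have h : σ.diag (∑ j, ∑ k, c j k •
      (clι n (EuclideanSpace.single j 1) * clι n (EuclideanSpace.single k 1))) =
      ∑ j, ∑ k, c j k • (σ.e j * σ.e k) := by
    let L : Cl n →ₗ[ℝ] Module.End ℂ (Dbl S) :=
      { toFun := σ.diag
        map_add' := fun x y => by rw [diag, map_add]; rfl
        map_smul' := fun c x => by rw [diag, map_smul]; rfl }
    change L _ = _
    simp only [map_sum, map_smul, ← diag_e_mul_e]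
    rfl
  have hL (q : Dbl S) : σ.dhidden p q = σ.dhiddenLin p q := rfl
  rw [h, hL]
  simp only [LinearMap.sum_apply, map_sum, LinearMap.smul_apply]
  refine Finset.sum_congr rfl fun j _ => Finset.sum_congr rfl fun k _ => ?_
  rw [LinearMap.map_smul]
  -- Antisymmetry of c removes the diagonal, where `dhidden_rotation` does not apply.
  by_cases hjk : j = k
  · subst hjk
    have : c j j = 0 := by linarith [hc j j]
    rw [this, zero_smul, zero_smul]
  · rw [← hL, dhidden_rotation σ p hjk]

lemma dhidden_killing (κ w : EucSp n) (p : Dbl S) :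
    σ.dhidden p (-(1 / 2 : ℂ) • ∑ j, (κ j : ℂ) • σ.e j (e0 p) - (Complex.I / 2) • σ.cl w p) =
      -(1 / 2 : ℂ) • ∑ j, (κ j : ℂ) • σ.e j (e0 (σ.hidden p))
        - (Complex.I / 2) • σ.cl w (σ.hidden p) := by
  -- `dhidden p` is only real linear, so the Killing operator is first written with real
  -- coefficients in the generators e_j e₀ and 𝐢 e_j.
  have h (q : Dbl S) :
      -(1 / 2 : ℂ) • ∑ j, (κ j : ℂ) • σ.e j (e0 q) - (Complex.I / 2) • σ.cl w q =
      (-(1 / 2) : ℝ) • ∑ j, (κ j • (σ.e j * e0 : Module.End ℂ (Dbl S)) q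
        + w j • (Complex.I • σ.e j : Module.End ℂ (Dbl S)) q) := by
    have h1 : -(1 / 2 : ℂ) = ((-(1 / 2) : ℝ) : ℂ) := by push_cast; rfl
    have h2 (x : Dbl S) : (Complex.I / 2) • x = (1 / 2 : ℝ) • Complex.I • x := by
      rw [← Complex.coe_smul, smul_smul]
      congr 1
      push_cast
      ring
    rw [h1, Complex.coe_smul, h2, cl_eq_sum]
    simp only [Complex.coe_smul, LinearMap.sum_apply, LinearMap.smul_apply, Finset.smul_sum,
      Finset.sum_add_distrib, smul_add, Module.End.mul_apply, smul_comm Complex.I, neg_smul,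
      Finset.sum_neg_distrib, sub_eq_add_neg]
  have hL (q : Dbl S) : σ.dhidden p q = σ.dhiddenLin p q := rfl
  rw [h, h, hL, LinearMap.map_smul, map_sum]
  simp only [LinearMap.map_add, LinearMap.map_smul (σ.dhiddenLin p)]
  simp only [← hL, dhidden_boost, dhidden_imag]

end SpinorModule

/-- Two orthonormal families of maximal size differ by an orthogonal matrix. -/
lemma exists_orthogonal_matrix {n : ℕ} {V : Type*} [AddCommGroup V] [Module ℝ V]
    (hV : Module.finrank ℝ V = n) (B : V →ₗ[ℝ] V →ₗ[ℝ] ℝ) {E F : Fin n → V}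
    (hE : ∀ i j, B (E i) (E j) = if i = j then 1 else 0)
    (hF : ∀ i j, B (F i) (F j) = if i = j then 1 else 0) :
    ∃ R : Matrix (Fin n) (Fin n) ℝ, R * R.transpose = 1 ∧ ∀ i, F i = ∑ j, R i j • E j := by
  have hli : LinearIndependent ℝ E := by
    rw [Fintype.linearIndependent_iff]
    intro c hc i
    have := congrArg (fun v => B v (E i)) hc
    simpa [hE] using this
  -- Building a basis from independence and cardinality needs a nonempty index type, so n = 0 is
  -- treated apart.
  rcases isEmpty_or_nonempty (Fin n) with hn | hn
  · exact ⟨1, by simp, fun i => hn.elim i⟩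
  let b := basisOfLinearIndependentOfCardEqFinrank hli (by simp [hV])
  have hb : ⇑b = E := coe_basisOfLinearIndependentOfCardEqFinrank hli _
  have hR (i : Fin n) : F i = ∑ j, b.repr (F i) j • E j := by
    conv_lhs => rw [← b.sum_repr (F i), hb]
  refine ⟨Matrix.of fun i j => b.repr (F i) j, ?_, hR⟩
  ext i k
  rw [Matrix.mul_apply, Matrix.one_apply, ← hF i k]
  conv_rhs => rw [hR i, hR k]
  simp [hE, mul_comm]

/-! ### From the model fibre to the spinor bundle -/

namespace SpinStructure

variable {n : ℕ} {M : Type*} [TopologicalSpace M] [ChartedSpace (EucSp n) M]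
  [IsManifold (𝓡 n) ∞ M] {g : RMetric n M} {ι : Type*}
  {S : Type*} [NormedAddCommGroup S] [InnerProductSpace ℂ S] [FiniteDimensional ℂ S]
  (P : SpinStructure g ι) {σ : SpinorModule n S}

/-- Metric compatibility of the connection; in the Koszul formula it follows from antisymmetry of
the Lie bracket alone. -/
lemma connCoeff_swap (a : ι) (x : M) (i j k : Fin n) :
    P.connCoeff a x i j k = -P.connCoeff a x i k j := by
  have h (i j k : Fin n) : g.inner x (VectorField.mlieBracket (𝓡 n) (P.frame a i) (P.frame a j) x)
      (P.frame a k x) = -g.inner x (VectorField.mlieBracket (𝓡 n) (P.frame a j) (P.frame a i) x)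
      (P.frame a k x) := by
    rw [VectorField.mlieBracket_swap_apply, map_neg, neg_apply]
  simp only [connCoeff]
  rw [h i k j, h k j i, h j i k]
  ring

/-- Independence of the trivialization: the two frames at y differ by an orthogonal matrix, which
the cocycle element covers, and `hidden` commutes with that element. -/
lemma localRep_hiddenSpinor (ψ : P.Spinor σ) {a : ι} {y : M} (hy : y ∈ P.baseSet a) :
    P.localRep a (P.hiddenSpinor ψ) y = σ.hidden (P.localRep a ψ y) := by
  have hy' := P.mem_baseSet_at y
  let B : TangentSpace (𝓡 n) y →ₗ[ℝ] TangentSpace (𝓡 n) y →ₗ[ℝ] ℝ :=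
    LinearMap.mk₂ ℝ (fun v w => g.inner y v w) (by simp) (by simp) (by simp) (by simp)
  obtain ⟨R, hR, hRF⟩ := exists_orthogonal_matrix (V := TangentSpace (𝓡 n) y)
    (finrank_euclideanSpace_fin (𝕜 := ℝ)) B (P.orthonormal a y hy)
    (P.orthonormal (P.indexAt y) y hy')
  refine (σ.hidden_diag (P.lift_mem a (P.indexAt y) y ⟨hy, hy'⟩) hR (fun i => ?_) (ψ y)).symm
  refine P.lift_covers a (P.indexAt y) y ⟨hy, hy'⟩ _ _ ?_
  exact (hRF i).symm.trans (by simp [PiLp.single_apply])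

lemma localRep_hiddenSpinor_eventuallyEq (ψ : P.Spinor σ) (x : M) :
    P.localRep (P.indexAt x) (P.hiddenSpinor ψ) =ᶠ[nhds x]
      fun y => σ.hidden (P.localRep (P.indexAt x) ψ y) := by
  filter_upwards [(P.isOpen_baseSet (P.indexAt x)).mem_nhds (P.mem_baseSet_at x)] with y hy
  exact P.localRep_hiddenSpinor ψ hy

lemma localRep_indexAt (ψ : P.Spinor σ) (x : M) : P.localRep (P.indexAt x) ψ x = ψ x :=
  (P.spinorBundle σ).coordChange_self _ x (P.mem_baseSet_at x) _

lemma isCr_iff (r : ℕ∞) (ψ : P.Spinor σ) :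
    P.IsCr r ψ ↔ ∀ x, ContMDiffAt (𝓡 n) 𝓘(ℝ, Dbl S) r (P.localRep (P.indexAt x) ψ) x :=
  forall_congr' fun x => contMDiffAt_section x

end SpinStructure

end

/-! ### The chain rule in a trivialization -/

theorem theorem1p6 {n : ℕ} {M : Type*} [TopologicalSpace M] [ChartedSpace (EucSp n) M]
    [IsManifold (𝓡 n) ∞ M] (g : RMetric n M)
    (k : ∀ x : M, TangentSpace (𝓡 n) x →ₗ[ℝ] TangentSpace (𝓡 n) x →ₗ[ℝ] ℝ)
    (hk : ∀ (x : M) (v w : TangentSpace (𝓡 n) x), k x v w = k x w v)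
    {S : Type*} [NormedAddCommGroup S] [InnerProductSpace ℂ S] [FiniteDimensional ℂ S]
    (σ : SpinorModule n S) {ι : Type*} (P : SpinStructure g ι)
    (r : ℕ∞) (hr : 1 ≤ r) (ψ : P.Spinor σ) (hψ : P.IsCr r ψ) (hK : P.IsKillingSpinor k ψ) :
    P.IsCr r (P.hiddenSpinor ψ) ∧ P.IsKillingSpinor k (P.hiddenSpinor ψ) := by
  rw [P.isCr_iff] at hψ
  refine ⟨(P.isCr_iff r _).2 fun x => ?_, fun x v => ?_⟩
  · have h : ContMDiffAt 𝓘(ℝ, Dbl S) 𝓘(ℝ, Dbl S) r σ.hidden (P.localRep (P.indexAt x) ψ x) :=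
      (σ.contDiff_hidden.of_le (by exact_mod_cast le_top)).contMDiff.contMDiffAt
    exact (h.comp x (hψ x)).congr_of_eventuallyEq (P.localRep_hiddenSpinor_eventuallyEq ψ x)
  -- c is the connection form evaluated on v, with the factor ¼ of the spin connection included.
  · obtain ⟨c, hc⟩ : ∃ c : Fin n → Fin n → ℝ,
        c = fun j k => ∑ i, P.coord x v i * P.connCoeff (P.indexAt x) x i j k / 4 := ⟨_, rfl⟩
    have hcswap (j k : Fin n) : c j k = -c k j := by
      rw [hc, ← Finset.sum_neg_distrib]
      refine Finset.sum_congr rfl fun i _ => ?_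
      rw [P.connCoeff_swap]
      ring
    have hΩ : ∑ i, ∑ j, ∑ k, (P.coord x v i * P.connCoeff (P.indexAt x) x i j k / 4) •
        (clι n (EuclideanSpace.single j 1) * clι n (EuclideanSpace.single k 1)) =
        ∑ j, ∑ k, c j k •
          (clι n (EuclideanSpace.single j 1) * clι n (EuclideanSpace.single k 1)) := by
      rw [Finset.sum_comm]
      refine Finset.sum_congr rfl fun j _ => ?_
      rw [Finset.sum_comm]
      refine Finset.sum_congr rfl fun k _ => ?_
      rw [hc, Finset.sum_smul]
    let dloc (χ : P.Spinor σ) : TangentSpace (𝓡 n) x →L[ℝ] Dbl S :=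
      mfderiv (𝓡 n) 𝓘(ℝ, Dbl S) (P.localRep (P.indexAt x) χ) x
    have hnabla (χ : P.Spinor σ) : P.nabla χ x v = dloc χ v +
          σ.diag (∑ j, ∑ k, c j k • (clι n (EuclideanSpace.single j 1) *
            clι n (EuclideanSpace.single k 1))) (χ x) := by
      rw [← hΩ]; rfl
    have hd : MDifferentiableAt (𝓡 n) 𝓘(ℝ, Dbl S) (P.localRep (P.indexAt x) ψ) x :=
      (hψ x).mdifferentiableAt (by
        have : (r : WithTop ℕ∞) ≠ 0 := by
          have := (zero_lt_one.trans_le hr).ne'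
          exact_mod_cast this
        exact this)
    have hh : MDifferentiableAt 𝓘(ℝ, Dbl S) 𝓘(ℝ, Dbl S) σ.hidden
        (P.localRep (P.indexAt x) ψ x) :=
      (σ.contDiff_hidden.differentiable (by simp) _).mdifferentiableAt
    have hderiv : dloc (P.hiddenSpinor ψ) v = σ.dhidden (ψ x) (dloc ψ v) := by
      dsimp only [dloc]
      rw [(P.localRep_hiddenSpinor_eventuallyEq ψ x).mfderiv_eq]
      have := mfderiv_comp x hh hd
      rw [mfderiv_eq_fderiv] at this
      refine (DFunLike.congr_fun this v).trans ?_
      refine (σ.fderiv_hidden_apply _ _).trans ?_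
      exact congrArg (fun p => σ.dhidden p (dloc ψ v)) (P.localRep_indexAt ψ x)
    have hKx := hK x v
    rw [hnabla] at hKx ⊢
    rw [hderiv]
    -- With Ω the connection term: ∇φ = dhidden(∂ψ) + Ω hidden(ψ) = dhidden(∂ψ + Ωψ) = dhidden(∇ψ),
    -- and then the Killing equation for ψ is substituted.
    refine Eq.trans ?_ (σ.dhidden_killing
      (WithLp.toLp 2 fun j => k x v (P.frame (P.indexAt x) j x)) (P.coord x v) (ψ x))
    refine Eq.trans ?_ (congrArg (σ.dhidden (ψ x)) hKx)
    exact (congrArg (σ.dhidden (ψ x) (dloc ψ v) + ·) (σ.dhidden_diag c hcswap (ψ x))).symm.trans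
      (σ.dhidden_add (ψ x) _ _).symm
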